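/- Let $d$ be a prime, $N$ a natural number, and $\mathcal H=(\mathbb C^d)^{\otimes N}$ with computational basis $|j\rangle$, $j\in\mathbb Z_d^N$. Put $\omega=e^{2\pi i/d}$ and, for $a,b\in\mathbb Z_d^N$, let $X^aZ^b|j\rangle=\omega^{b\cdot j}|a+j\rangle$. The generalized Pauli group $\mathcal P_{N,d}$ consists of the operators $cX^aZ^b$ with $c^{2d}=1$, and the Clifford group $\mathcal C_{N,d}$ is the normalizer of $\mathcal P_{N,d}$ in the unitary group of $\mathcal H$. A *stabilizer state* is a unit vector $|s\rangle$ fixed by every element of some abelian subgroup of $\mathcal P_{N,d}$ of order $d^N$. A *Clifford-stabilizer state* is a unit vector $|\psi\rangle$ such that, for some finite subgroup $Q\subset\mathcal C_{N,d}$, the stabilized space $\{v\in\mathcal H: gv=v\ \forall g\in Q\}$ equals $\mathbb C|\psi\rangle$. For unit vectors $|\phi\rangle$ define: * (for odd $d$) the mana $\mathcal M(\phi)=\log\sum_{\chi\in\mathbb Z_d^N\times\mathbb Z_d^N}|W_\chi(\phi)|$, where $W_\chi(\phi)=d^{-N}\operatorname{Tr}(A_\chi|\phi\rangle\langle\phi|)$,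 $A_\chi=d^{-N}\sum_{\chi'}\omega^{-\langle\chi,\chi'\rangle}T_{\chi'}$, $T_{(p,q)}=\omega^{2^{-1}p\cdot q}X^pZ^q$ (with $2^{-1}$ the inverse of $2$ in $\mathbb Z_d$) and $\langle(p,q),(p',q')\rangle=p\cdot q'-q\cdot p'$; * for real $\alpha\ge 2$, the stabilizer $\alpha$-Rényi entropy $M_\alpha(\phi)=\frac1{1-\alpha}\log\Big[d^{-(1-\alpha)N}\sum_{(p,q)}P_{(p,q)}(\phi)^\alpha\Big]$ with $P_{(p,q)}(\phi)=d^{-N}|\langle\phi|X^pZ^q|\phi\rangle|^2$; * the stabilizer fidelity $F(\phi)=\max_{s}|\langle\phi|s\rangle|^2$, the maximum being over all stabilizer states $s$, and the min-relative entropy of magic $\mathcal D_{\min}(\phi)=-\log F(\phi)$. For a continuous function $h:\mathbb R\to\mathbb R$, call $x$ an *extremal point* of $h$ if $h'(x)$ exists and is $0$, or $x$ is a local minimum or a local maximum of $h$, or $h$ is constant near $x$. Say that a function $f$ of unit vectors is *extremal at $\psi$ over all pure states* if for every smooth curve $\gamma:\mathbb R\to\mathcal H$ of unit vectors with $\gamma(0)=|\psi\rangle$,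 the function $t\mapsto f(\gamma(t))$ is continuous and has $0$ as an extremal point. (In particular this applies to $\varepsilon\mapsto(|\psi\rangle+\varepsilon|\varphi\rangle)/\sqrt{1+\varepsilon^2}$ for every unit vector $\varphi\perp\psi$, with no further restriction on $\varphi$.) **Corollary.** Let $|\psi\rangle$ be a Clifford-stabilizer state. Then, over all pure states, each of the following is extremal at $\psi$: the mana (if $d$ is odd), the stabilizer Rényi entropy $M_\alpha$ for every real $\alpha\ge2$, the stabilizer fidelity $F$, and the min-relative entropy of magic $\mathcal D_{\min}$. -/

import Mathlib

open scoped Matrix ContDiff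

noncomputable section

namespace QuditMagic

/-- The Hilbert space `(ℂ^d)^{⊗N}` of `N` qudits, in coordinates with respect to the computational
basis `|j⟩`, `j ∈ (ℤ/d)^N`. -/
abbrev QuditSpace (N d : ℕ) [Fact d.Prime] : Type :=
  EuclideanSpace ℂ (Fin N → ZMod d)

/-- Linear operators on `(ℂ^d)^{⊗N}`, as matrices in the computational basis. -/
abbrev QuditOp (N d : ℕ) [Fact d.Prime] : Type :=
  Matrix (Fin N → ZMod d) (Fin N → ZMod d) ℂ

/-- The unitary group of `(ℂ^d)^{⊗N}`. -/
abbrev QuditUnitary (N d : ℕ) [Fact d.Prime] : Type :=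
  Matrix.unitaryGroup (Fin N → ZMod d) ℂ

variable {N d : ℕ} [Fact d.Prime]

/-- `ω ^ x` for `x ∈ ℤ/d`, where `ω = exp (2 π i / d)`. -/
def omegaPow (x : ZMod d) : ℂ := ZMod.stdAddChar x

/-- The operator `X^a Z^b`, that is `X^a Z^b |j⟩ = ω^{b·j} |a + j⟩`. -/
def pauliOp (a b : Fin N → ZMod d) : QuditOp N d :=
  Matrix.of fun i j => if i = a + j then omegaPow (b ⬝ᵥ j) else 0

theorem omegaPow_add (x y : ZMod d) : omegaPow (x + y) = omegaPow x * omegaPow y :=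
  AddChar.map_add_eq_mul _ _ _

theorem omegaPow_zero : omegaPow (0 : ZMod d) = 1 :=
  AddChar.map_zero_eq_one _

theorem omegaPow_pow (x : ZMod d) : omegaPow x ^ (2 * d) = 1 := by
  unfold omegaPow
  rw [← AddChar.map_nsmul_eq_pow]
  simp

theorem star_omegaPow (x : ZMod d) : star (omegaPow x) = omegaPow (-x) :=
  (AddChar.map_neg_eq_conj _ _).symm

theorem pauliOp_zero : pauliOp (0 : Fin N → ZMod d) 0 = 1 := by
  ext i j
  simp [pauliOp, Matrix.one_apply, omegaPow_zero]

theorem pauliOp_mul (a b a' b' : Fin N → ZMod d) :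
    pauliOp a b * pauliOp a' b' = omegaPow (b ⬝ᵥ a') • pauliOp (a + a') (b + b') := by
  ext i j
  simp only [pauliOp, Matrix.mul_apply, Matrix.of_apply, Matrix.smul_apply, smul_eq_mul]
  rw [Finset.sum_eq_single (a' + j)]
  · simp only [if_true, add_assoc]
    split_ifs
    · rw [← omegaPow_add, ← omegaPow_add, dotProduct_add, add_dotProduct, add_assoc]
    · simp
  · intro k _ hk
    simp [hk]
  · simp

theorem star_pauliOp (a b : Fin N → ZMod d) :
    star (pauliOp a b) = omegaPow (b ⬝ᵥ a) • pauliOp (-a) (-b) := by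
  ext i j
  simp only [pauliOp, Matrix.star_apply, Matrix.of_apply, Matrix.smul_apply, smul_eq_mul]
  by_cases h : j = a + i
  · subst h
    simp only [if_true, neg_add_cancel_left, star_omegaPow, ← omegaPow_add]
    congr 1
    simp only [dotProduct_add, neg_dotProduct]
    ring
  · have h' : ¬ i = -a + j := fun e => h (by rw [e]; abel)
    simp [h, h']

/-- The generalized Pauli group: all unitaries `c X^a Z^b` whose phase `c` is a `2d`-th root of
unity. The phases `(-1)^x ζ^k` with `ζ = exp (π i / d)`, `x ∈ {0, 1}`, `0 ≤ k < d` are exactly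
these. The group has order `2 d^(2N+1)`. -/
def pauliGroup (N d : ℕ) [Fact d.Prime] : Subgroup (QuditUnitary N d) where
  carrier := {U | ∃ (c : ℂ) (a b : Fin N → ZMod d),
    c ^ (2 * d) = 1 ∧ (U : QuditOp N d) = c • pauliOp a b}
  one_mem' := ⟨1, 0, 0, one_pow _, by simp [pauliOp_zero]⟩
  mul_mem' := by
    rintro U V ⟨c, a, b, hc, hU⟩ ⟨c', a', b', hc', hV⟩
    refine ⟨c * c' * omegaPow (b ⬝ᵥ a'), a + a', b + b', ?_, ?_⟩
    · rw [mul_pow, mul_pow, hc, hc', omegaPow_pow]; norm_num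
    · rw [Matrix.UnitaryGroup.mul_val, hU, hV, smul_mul_smul_comm, pauliOp_mul, smul_smul]
  inv_mem' := by
    rintro U ⟨c, a, b, hc, hU⟩
    refine ⟨star c * omegaPow (b ⬝ᵥ a), -a, -b, ?_, ?_⟩
    · rw [mul_pow, ← star_pow, hc, omegaPow_pow]; simp
    · rw [Matrix.UnitaryGroup.inv_val, hU, star_smul, star_pauliOp, smul_smul]

/-- The Clifford group (global phases included): the normalizer of the generalized Pauli group in
the unitary group. -/
def cliffordGroup (N d : ℕ) [Fact d.Prime] : Subgroup (QuditUnitary N d) :=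
  Subgroup.normalizer (pauliGroup N d : Set (QuditUnitary N d))

/-- The unitary `U` stabilizes the vector `ψ`: `U ψ = ψ`. -/
def Stabilizes (U : QuditUnitary N d) (ψ : QuditSpace N d) : Prop :=
  (U : QuditOp N d) *ᵥ ψ.ofLp = ψ.ofLp

/-- The stabilized space of a group `G` of unitaries: all `ψ` with `g ψ = ψ` for every `g ∈ G`. -/
def stabilizedSpace (G : Subgroup (QuditUnitary N d)) : Submodule ℂ (QuditSpace N d) where
  carrier := {ψ | ∀ g ∈ G, Stabilizes g ψ}
  zero_mem' := fun g _ => by simp [Stabilizes]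
  add_mem' := fun {x y} hx hy g hg => by
    have h1 := hx g hg
    have h2 := hy g hg
    simp only [Stabilizes] at h1 h2 ⊢
    rw [WithLp.ofLp_add, Matrix.mulVec_add, h1, h2]
  smul_mem' := fun c x hx g hg => by
    have h1 := hx g hg
    simp only [Stabilizes] at h1 ⊢
    rw [WithLp.ofLp_smul, Matrix.mulVec_smul, h1]

/-- A Clifford-stabilizer state: a unit vector which spans the (one-dimensional) stabilized space of
some finite subgroup of the Clifford group. -/
def IsCliffordStabilizerState (ψ : QuditSpace N d) : Prop :=
  ‖ψ‖ = 1 ∧ ∃ Q : Subgroup (QuditUnitary N d),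
    Q ≤ cliffordGroup N d ∧ Finite Q ∧ stabilizedSpace Q = Submodule.span ℂ {ψ}

/-- A (pure) stabilizer state: a unit vector which is a simultaneous eigenvector, with eigenvalue
`+1`, of an abelian subgroup of order `d^N` of the generalized Pauli group. -/
def IsStabilizerState (s : QuditSpace N d) : Prop :=
  ‖s‖ = 1 ∧ ∃ S : Subgroup (QuditUnitary N d),
    S ≤ pauliGroup N d ∧ (∀ g ∈ S, ∀ h ∈ S, g * h = h * g) ∧ Nat.card S = d ^ N ∧
      ∀ g ∈ S, Stabilizes g s

/-- The rank-one operator `|ψ⟩⟨ψ|`. -/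
def pureState (ψ : QuditSpace N d) : QuditOp N d :=
  Matrix.vecMulVec ψ.ofLp (star ψ.ofLp)

/-- The discrete phase space `(ℤ/d)^N × (ℤ/d)^N`, with points `χ = (p, q)`. -/
abbrev PhaseSpace (N d : ℕ) [Fact d.Prime] : Type :=
  (Fin N → ZMod d) × (Fin N → ZMod d)

/-- The symplectic product `⟨(p, q), (p', q')⟩ = p·q' - q·p'`. -/
def symplecticForm (χ χ' : PhaseSpace N d) : ZMod d :=
  χ.1 ⬝ᵥ χ'.2 - χ.2 ⬝ᵥ χ'.1

/-- The Heisenberg-Weyl displacement operator `T_χ = τ^{p·q} X^p Z^q`, `τ = ω^{1/2}`, with `1/2`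
taken in `ℤ/d`. Used for odd `d` only. -/
def displacementOp (χ : PhaseSpace N d) : QuditOp N d :=
  omegaPow (2⁻¹ * (χ.1 ⬝ᵥ χ.2)) • pauliOp χ.1 χ.2

/-- The phase point operator `A_χ = d^{-N} ∑_χ' ω^{-⟨χ, χ'⟩} T_χ'`. Used for odd `d` only. -/
def phasePointOp (χ : PhaseSpace N d) : QuditOp N d :=
  ((d : ℂ) ^ N)⁻¹ • ∑ χ' : PhaseSpace N d, omegaPow (-symplecticForm χ χ') • displacementOp χ'

/-- The discrete Wigner function `W_χ(ρ) = d^{-N} Tr (A_χ ρ)`; its values are real when `ρ` is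
Hermitian. Used for odd `d` only. -/
def wigner (χ : PhaseSpace N d) (ρ : QuditOp N d) : ℂ :=
  ((d : ℂ) ^ N)⁻¹ * (phasePointOp χ * ρ).trace

/-- The mana `log ∑_χ |W_χ(ρ)|`. Used for odd `d` only. -/
def mana (ρ : QuditOp N d) : ℝ :=
  Real.log (∑ χ : PhaseSpace N d, ‖wigner χ ρ‖)

/-- `P_χ(ψ) = d^{-N} |⟨ψ| X^p Z^q |ψ⟩|²`, for `χ = (p, q)`. The operators `X^p Z^q` represent all
Pauli operators modulo phases, and the value does not depend on the phase. -/
def pauliProb (χ : PhaseSpace N d) (ψ : QuditSpace N d) : ℝ :=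
  ((d : ℝ) ^ N)⁻¹ * ‖star ψ.ofLp ⬝ᵥ (pauliOp χ.1 χ.2 *ᵥ ψ.ofLp)‖ ^ 2

/-- The stabilizer `α`-Rényi entropy
`M_α(ψ) = (1 - α)⁻¹ log (d^{-(1-α)N} ∑_χ P_χ(ψ)^α)`. -/
def stabilizerRenyiEntropy (α : ℝ) (ψ : QuditSpace N d) : ℝ :=
  1 / (1 - α) *
    Real.log (1 / (d : ℝ) ^ ((1 - α) * (N : ℝ)) * ∑ χ : PhaseSpace N d, pauliProb χ ψ ^ α)

/-- The stabilizer fidelity: the largest squared overlap `|⟨ψ|s⟩|²` with a stabilizer state `s`. -/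
def stabilizerFidelity (ψ : QuditSpace N d) : ℝ :=
  ⨆ s : {s : QuditSpace N d // IsStabilizerState s}, ‖inner ℂ ψ s.1‖ ^ 2

/-- The min-relative entropy of magic of a pure state. -/
def minRelativeEntropyOfMagic (ψ : QuditSpace N d) : ℝ :=
  -Real.log (stabilizerFidelity ψ)

/-- An extremal point of a continuous function on the real line: a critical point, a local minimum,
a local maximum, or a point near which the function is constant. -/
def IsExtremalPoint (f : ℝ → ℝ) (x : ℝ) : Prop :=
  Continuous f ∧
    (HasDerivAt f 0 x ∨ IsLocalMin f x ∨ IsLocalMax f x ∨ ∀ᶠ y in nhds x, f y = f x)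

/-- `ψ` is an extremal point of `f` on pure states: along every smooth curve of unit vectors that
passes through `ψ` at time `0`, the time `0` is an extremal point of `f`. The curves include the
variations `ε ↦ (ψ + ε φ) / √(1 + ε²)` with `φ` a unit vector orthogonal to `ψ`. -/
def IsExtremalOnPureStates (f : QuditSpace N d → ℝ) (ψ : QuditSpace N d) : Prop :=
  ∀ γ : ℝ → QuditSpace N d, ContDiff ℝ ∞ γ → (∀ t, ‖γ t‖ = 1) → γ 0 = ψ →
    IsExtremalPoint (fun t => f (γ t)) 0

end QuditMagic

end

open scoped Matrix ContDiff

noncomputable section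

namespace QuditMagic

variable {N d : ℕ} [Fact d.Prime]

/-! ### Extremality at a point of logarithms, sums of moduli and finite maxima. -/

section ExtremalPoints

/-! Let `Q` be a finite Clifford group whose fixed space is the line of ψ, and let v be the velocity
at ψ of a curve of unit vectors. The sum of g v over `Q` is fixed by `Q`, hence a multiple of ψ.
Since Re⟨ψ, v⟩ = 0 and every g fixes ψ, the multiple is imaginary, so the sum points along the
global phase. For phase-invariant p differentiable at ψ, the slopes of t ↦ p (g (γ t)) therefore sum
to zero (`exists_hasDerivAt_sum_eq_zero`). If p is also `Q`-invariant, the slopes coincide and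
vanish (`hasDerivAt_zero_of_invariant`). This settles the Rényi entropy, because Cliffords permute
Pauli operators up to phase.

The other quantities are not smooth. In the mana, the Wigner values nonzero at ψ are permuted among
themselves by `Q`, and the sum of their moduli is critical. The remaining values vanish at ψ: they
contribute either zero slope or a kink of order |t| that forces a local minimum. The fidelity is a
maximum of finitely many smooth projection weights, permuted by `Q`. A maximizing weight with
nonzero slope has an orbit of equally large weights whose slopes sum to zero, so both signs occur
and the maximum has a local minimum. Logarithm and sign change preserve extremality. -/

theorem IsExtremalPoint.log {f : ℝ → ℝ} {x : ℝ} (hf : IsExtremalPoint f x) (hpos : ∀ t, 0 < f t) :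
    IsExtremalPoint (fun t => Real.log (f t)) x := by
  obtain ⟨hc, h⟩ := hf
  refine ⟨hc.log fun t => (hpos t).ne', ?_⟩
  rcases h with h | h | h | h
  · left
    simpa using h.log (hpos x).ne'
  · right; left
    filter_upwards [h] with t ht using Real.log_le_log (hpos x) ht
  · right; right; left
    filter_upwards [h] with t ht using Real.log_le_log (hpos t) ht
  · right; right; right
    filter_upwards [h] with t ht
    rw [ht]

theorem IsExtremalPoint.neg {f : ℝ → ℝ} {x : ℝ} (hf : IsExtremalPoint f x) :
    IsExtremalPoint (fun t => -f t) x := by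
  obtain ⟨hc, h⟩ := hf
  refine ⟨hc.neg, ?_⟩
  rcases h with h | h | h | h
  · left
    simpa using h.fun_neg
  · right; right; left
    exact h.neg
  · right; left
    exact h.neg
  · right; right; right
    filter_upwards [h] with t ht
    rw [ht]

/-- A first-order expansion at `0` in `ε`-form. -/
theorem eventually_norm_sub_le_of_hasDerivAt {E : Type*} [NormedAddCommGroup E] [NormedSpace ℝ E]
    {u : ℝ → E} {u' : E} (h : HasDerivAt u u' 0) {ε : ℝ} (hε : 0 < ε) :
    ∀ᶠ t in nhds (0 : ℝ), ‖u t - u 0 - t • u'‖ ≤ ε * |t| := by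
  have := (hasDerivAt_iff_isLittleO.1 h).def hε
  simpa using this

theorem hasDerivAt_zero_of_eventually {f : ℝ → ℝ}
    (h : ∀ ε > 0, ∀ᶠ t in nhds (0 : ℝ), |f t - f 0| ≤ ε * |t|) : HasDerivAt f 0 0 := by
  rw [hasDerivAt_iff_isLittleO, Asymptotics.isLittleO_iff]
  intro ε hε
  simpa using h ε hε

/-- A critical function plus norms of differentiable functions that vanish at `0` is extremal
at `0`. -/
theorem isExtremalPoint_of_eq_add_sum_norm {ι : Type*} (s : Finset ι) {f G : ℝ → ℝ}
    {u : ι → ℝ → ℂ} {u' : ι → ℂ} (hf : Continuous f) (hG : HasDerivAt G 0 0)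
    (hu : ∀ i ∈ s, HasDerivAt (u i) (u' i) 0) (hu0 : ∀ i ∈ s, u i 0 = 0)
    (hfG : ∀ t, f t = G t + ∑ i ∈ s, ‖u i t‖) : IsExtremalPoint f 0 := by
  refine ⟨hf, ?_⟩
  have hf0 : f 0 = G 0 := by
    rw [hfG, Finset.sum_eq_zero fun i hi => by rw [hu0 i hi, norm_zero], add_zero]
  by_cases hall : ∀ i ∈ s, u' i = 0
  · left
    have hn : ∀ i ∈ s, HasDerivAt (fun t => ‖u i t‖) 0 0 := by
      intro i hi
      refine hasDerivAt_zero_of_eventually fun ε hε => ?_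
      have h := hu i hi
      rw [hall i hi] at h
      filter_upwards [eventually_norm_sub_le_of_hasDerivAt h hε] with t ht
      simpa [hu0 i hi] using ht
    have := hG.add (HasDerivAt.fun_sum hn)
    simp only [Finset.sum_const_zero, add_zero] at this
    exact this.congr_of_eventuallyEq (Filter.Eventually.of_forall hfG)
  · push Not at hall
    obtain ⟨j, hj, hj'⟩ := hall
    right; left
    -- With half the speed of `u j` as tolerance, `G` drops by at most ε|t| while ‖`u j t`‖ is at
    -- least ε|t|, so the sum cannot fall below its value at 0.
    have hε : 0 < ‖u' j‖ / 2 := by positivity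
    filter_upwards [eventually_norm_sub_le_of_hasDerivAt hG hε,
      eventually_norm_sub_le_of_hasDerivAt (hu j hj) hε] with t h1 h2
    rw [hf0, hfG]
    have h3 : ‖u j t‖ ≤ ∑ i ∈ s, ‖u i t‖ :=
      Finset.single_le_sum (f := fun i => ‖u i t‖) (fun i _ => norm_nonneg _) hj
    have h4 : |t| * ‖u' j‖ ≤ ‖u j t‖ + ‖u' j‖ / 2 * |t| := by
      rw [hu0 j hj, sub_zero] at h2
      have h5 := norm_sub_norm_le (t • u' j) (u j t)
      rw [norm_sub_rev, norm_smul, Real.norm_eq_abs] at h5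
      linarith
    rw [smul_zero, sub_zero, Real.norm_eq_abs] at h1
    have := (abs_le.1 h1).1
    linarith

/-- The maximum of finitely many differentiable functions is extremal at `0` if among the functions
that attain it there is no non-zero slope or there are slopes of both signs. -/
theorem isExtremalPoint_iSup {ι : Type*} [Finite ι] [Nonempty ι] {h : ι → ℝ → ℝ} {h' : ι → ℝ}
    (hc : ∀ i, Continuous (h i)) (hd : ∀ i, HasDerivAt (h i) (h' i) 0)
    (hmax : ∀ i, h i 0 = ⨆ j, h j 0 → h' i ≠ 0 →
      (∃ j, h j 0 = h i 0 ∧ 0 < h' j) ∧ ∃ j, h j 0 = h i 0 ∧ h' j < 0) :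
    IsExtremalPoint (fun t => ⨆ i, h i t) 0 := by
  have hle : ∀ i t, h i t ≤ ⨆ j, h j t := fun i t =>
    le_ciSup (f := fun j => h j t) (Set.finite_range _).bddAbove i
  obtain ⟨m, hm⟩ := exists_eq_ciSup_of_finite (f := fun i => h i 0)
  refine ⟨?_, ?_⟩
  · have := Fintype.ofFinite ι
    have e : (fun t => ⨆ i, h i t) =
        fun t => Finset.univ.sup' Finset.univ_nonempty fun i => h i t := by
      ext t
      exact (Finset.sup'_univ_eq_ciSup _).symm
    rw [e]
    exact Continuous.finset_sup'_apply _ fun i _ => hc i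
  by_cases hz : ∀ i, h i 0 = ⨆ j, h j 0 → h' i = 0
  · left
    refine hasDerivAt_zero_of_eventually fun ε hε => ?_
    -- Maximizers are flat to first order, and the other functions stay below the maximum by
    -- continuity.
    have key : ∀ i, ∀ᶠ t in nhds (0 : ℝ), h i t ≤ (⨆ j, h j 0) + ε * |t| := by
      intro i
      rcases (hle i 0).eq_or_lt with hi | hi
      · have hdi := hd i
        rw [hz i hi] at hdi
        filter_upwards [eventually_norm_sub_le_of_hasDerivAt hdi hε] with t ht
        rw [smul_zero, sub_zero, Real.norm_eq_abs] at ht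
        have := (abs_le.1 ht).2
        linarith
      · filter_upwards [(hc i).continuousAt.eventually_lt continuousAt_const hi] with t ht
        have : 0 ≤ ε * |t| := by positivity
        linarith
    have hdm := hd m
    rw [hz m hm] at hdm
    filter_upwards [Filter.eventually_all.2 key,
      eventually_norm_sub_le_of_hasDerivAt hdm hε] with t h1 h2
    rw [smul_zero, sub_zero, Real.norm_eq_abs] at h2
    have h3 := (abs_le.1 h2).1
    have h4 := hle m t
    have h5 : (⨆ i, h i t) ≤ (⨆ j, h j 0) + ε * |t| := ciSup_le h1
    rw [abs_le]
    constructor <;> linarith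
  · push Not at hz
    obtain ⟨i, hi, hi'⟩ := hz
    obtain ⟨⟨j, hj, hj'⟩, k, hk, hk'⟩ := hmax i hi hi'
    right; left
    -- The tolerance is the size of the slope itself: the rising function bounds the maximum from
    -- below for t ≥ 0, the falling one for t ≤ 0.
    filter_upwards [eventually_norm_sub_le_of_hasDerivAt (hd j) hj',
      eventually_norm_sub_le_of_hasDerivAt (hd k) (neg_pos.2 hk')] with t h1 h2
    rw [Real.norm_eq_abs, smul_eq_mul] at h1 h2
    rcases le_total 0 t with ht | ht
    · rw [abs_of_nonneg ht] at h1
      have := (abs_le.1 h1).1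
      have := hle j t
      nlinarith
    · rw [abs_of_nonpos ht] at h2
      have := (abs_le.1 h2).1
      have := hle k t
      nlinarith

end ExtremalPoints

/-! ### Averaging tangent vectors over a finite group that fixes only a line. -/

section Averaging

variable {H : Type*} [NormedAddCommGroup H] [InnerProductSpace ℂ H]

theorem re_inner_eq_zero_of_norm_eq_one {γ : ℝ → H} {v : H} (hγ : HasDerivAt γ v 0)
    (hnorm : ∀ t, ‖γ t‖ = 1) : (inner ℂ (γ 0) v).re = 0 := by
  have h1 := hγ.inner ℂ hγ
  have h2 : (fun t => inner ℂ (γ t) (γ t)) = fun _ => (1 : ℂ) := by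
    ext t
    rw [inner_self_eq_norm_sq_to_K, hnorm]
    simp
  rw [h2] at h1
  have h3 := h1.unique (hasDerivAt_const 0 (1 : ℂ))
  have h4 := congrArg Complex.re h3
  rw [Complex.add_re, ← inner_conj_symm v (γ 0), Complex.conj_re, Complex.zero_re] at h4
  linarith

variable {Q : Type*} [Group Q] [Fintype Q]

/-- Averaging a tangent vector over a finite group whose stabilized space is a line. -/
theorem exists_sum_apply_eq_I_smul (ρ : Q →* (H ≃ₗᵢ[ℂ] H)) {ψ : H} (hψ : ‖ψ‖ = 1)
    (hfix : ∀ g, ρ g ψ = ψ) (hspan : ∀ v, (∀ g, ρ g v = v) → v ∈ Submodule.span ℂ {ψ})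
    {v : H} (hv : (inner ℂ ψ v).re = 0) :
    ∃ r : ℝ, ∑ g, ρ g v = r • Complex.I • ψ := by
  obtain ⟨c, hc⟩ := Submodule.mem_span_singleton.1 (hspan (∑ g, ρ g v) fun g => by
    rw [map_sum]
    refine Fintype.sum_equiv (Equiv.mulLeft g) _ _ fun k => ?_
    simp [map_mul])
  refine ⟨c.im, ?_⟩
  -- Each g is an isometry fixing ψ, so every summand has the same overlap with ψ as v.
  have h1 : inner ℂ ψ (∑ g, ρ g v) = Fintype.card Q * inner ℂ ψ v := by
    rw [inner_sum, Finset.sum_congr rfl fun g _ => show inner ℂ ψ (ρ g v) = inner ℂ ψ v by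
      nth_rw 1 [← hfix g]
      exact (ρ g).inner_map_map _ _]
    simp
  rw [← hc, inner_smul_right, inner_self_eq_norm_sq_to_K, hψ] at h1
  have h2 : c.re = 0 := by
    have := congrArg Complex.re h1
    simpa [hv] using this
  rw [← hc, ← Complex.coe_smul, smul_smul]
  congr 1
  apply Complex.ext <;> simp [h2]

/-- I • ψ is the velocity of the phase orbit θ ↦ exp(iθ) ψ, on which `p` is constant. -/
theorem fderiv_I_smul_eq_zero {p : H → ℝ} {L : H →L[ℝ] ℝ} {ψ : H} (hp : HasFDerivAt p L ψ)
    (hphase : ∀ (c : ℂ) φ, ‖c‖ = 1 → p (c • φ) = p φ) : L (Complex.I • ψ) = 0 := by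
  have h1 : HasDerivAt (fun θ : ℝ => Complex.exp (θ * Complex.I) • ψ) (Complex.I • ψ) 0 := by
    have h := ((Complex.ofRealCLM.hasDerivAt (x := (0 : ℝ))).mul_const Complex.I).cexp
    simpa using h.smul_const ψ
  have h2 : HasFDerivAt p L (Complex.exp (((0 : ℝ) : ℂ) * Complex.I) • ψ) := by simpa using hp
  have h3 := h2.comp_hasDerivAt (0 : ℝ) h1
  have h4 : (p ∘ fun θ : ℝ => Complex.exp (θ * Complex.I) • ψ) = fun _ => p ψ := by
    ext θ
    exact hphase _ _ (Complex.norm_exp_ofReal_mul_I θ)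
  rw [h4] at h3
  exact h3.unique (hasDerivAt_const _ _)

/-- For a phase-invariant function `p` the slopes of `t ↦ p (g (γ t))`, `g ∈ Q`, sum to zero. -/
theorem exists_hasDerivAt_sum_eq_zero (ρ : Q →* (H ≃ₗᵢ[ℂ] H)) {ψ : H}
    (hfix : ∀ g, ρ g ψ = ψ) (hspan : ∀ v, (∀ g, ρ g v = v) → v ∈ Submodule.span ℂ {ψ})
    {γ : ℝ → H} (hγ : DifferentiableAt ℝ γ 0) (hnorm : ∀ t, ‖γ t‖ = 1) (hγ0 : γ 0 = ψ)
    {p : H → ℝ} (hp : DifferentiableAt ℝ p ψ)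
    (hphase : ∀ (c : ℂ) φ, ‖c‖ = 1 → p (c • φ) = p φ) :
    ∃ p' : Q → ℝ, (∀ g, HasDerivAt (fun t => p (ρ g (γ t))) (p' g) 0) ∧ ∑ g, p' g = 0 := by
  have hL := hp.hasFDerivAt
  have hv := hγ.hasDerivAt
  refine ⟨fun g => fderiv ℝ p ψ (ρ g (deriv γ 0)), fun g => ?_, ?_⟩
  · have h1 : HasDerivAt (fun t => ρ g (γ t)) (ρ g (deriv γ 0)) 0 :=
      ((ρ g).toContinuousLinearEquiv.toContinuousLinearMap.restrictScalars
        ℝ).hasFDerivAt.comp_hasDerivAt (0 : ℝ) hv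
    have h2 : HasFDerivAt p (fderiv ℝ p ψ) (ρ g (γ 0)) := by rwa [hγ0, hfix]
    exact h2.comp_hasDerivAt (0 : ℝ) h1
  · have hre := re_inner_eq_zero_of_norm_eq_one hv hnorm
    rw [hγ0] at hre
    obtain ⟨r, hr⟩ :=
      exists_sum_apply_eq_I_smul ρ (by rw [← hγ0, hnorm]) hfix hspan hre
    rw [← map_sum, hr, map_smul, fderiv_I_smul_eq_zero hL hphase, smul_zero]

theorem hasDerivAt_zero_of_invariant (ρ : Q →* (H ≃ₗᵢ[ℂ] H)) {ψ : H}
    (hfix : ∀ g, ρ g ψ = ψ) (hspan : ∀ v, (∀ g, ρ g v = v) → v ∈ Submodule.span ℂ {ψ})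
    {γ : ℝ → H} (hγ : DifferentiableAt ℝ γ 0) (hnorm : ∀ t, ‖γ t‖ = 1) (hγ0 : γ 0 = ψ)
    {p : H → ℝ} (hp : DifferentiableAt ℝ p ψ)
    (hphase : ∀ (c : ℂ) φ, ‖c‖ = 1 → p (c • φ) = p φ) (hinv : ∀ g φ, p (ρ g φ) = p φ) :
    HasDerivAt (fun t => p (γ t)) 0 0 := by
  obtain ⟨p', h1, h2⟩ := exists_hasDerivAt_sum_eq_zero ρ hfix hspan hγ hnorm hγ0 hp hphase
  simp only [hinv] at h1
  have h3 : ∀ g, p' g = p' 1 := fun g => (h1 g).unique (h1 1)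
  rw [Finset.sum_congr rfl fun g _ => h3 g, Finset.sum_const, smul_eq_zero] at h2
  have h4 := h1 1
  rwa [h2.resolve_left (by simp)] at h4

end Averaging

/-! ### Unitaries acting on states, and expectation values. -/

section UnitaryAction

/-- The action of the unitary group on `(ℂ^d)^{⊗N}` by linear isometries. -/
def unitaryAction : QuditUnitary N d →* (QuditSpace N d ≃ₗᵢ[ℂ] QuditSpace N d) :=
  (Unitary.linearIsometryEquiv (𝕜 := ℂ) (H := QuditSpace N d)).toMonoidHom.comp
    (Unitary.map
      { toFun := Matrix.toEuclideanCLM (𝕜 := ℂ) (n := Fin N → ZMod d)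
        map_one' := map_one _
        map_mul' := map_mul _
        map_star' := map_star _ }).toMonoidHom

theorem ofLp_unitaryAction (U : QuditUnitary N d) (φ : QuditSpace N d) :
    (unitaryAction U φ).ofLp = (U : QuditOp N d) *ᵥ φ.ofLp :=
  rfl

theorem stabilizes_iff {U : QuditUnitary N d} {φ : QuditSpace N d} :
    Stabilizes U φ ↔ unitaryAction U φ = φ := by
  rw [Stabilizes, ← ofLp_unitaryAction]
  exact (WithLp.ofLp_injective 2).eq_iff

theorem mem_stabilizedSpace {G : Subgroup (QuditUnitary N d)} {φ : QuditSpace N d} :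
    φ ∈ stabilizedSpace G ↔ ∀ g ∈ G, unitaryAction g φ = φ :=
  forall₂_congr fun _ _ => stabilizes_iff

/-- The expectation `⟨φ|B|φ⟩`. -/
def expectation (B : QuditOp N d) (φ : QuditSpace N d) : ℂ :=
  star φ.ofLp ⬝ᵥ (B *ᵥ φ.ofLp)

theorem expectation_eq_inner (B : QuditOp N d) (φ : QuditSpace N d) :
    expectation B φ = inner ℂ φ (Matrix.toEuclideanCLM (𝕜 := ℂ) B φ) := by
  rw [EuclideanSpace.inner_eq_star_dotProduct, dotProduct_comm]
  rfl

theorem differentiable_expectation (B : QuditOp N d) : Differentiable ℝ (expectation B) := by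
  have h : expectation B = fun φ => inner ℂ φ (Matrix.toEuclideanCLM (𝕜 := ℂ) B φ) :=
    funext (expectation_eq_inner B)
  rw [h]
  exact differentiable_id.inner ℂ
    (((Matrix.toEuclideanCLM (𝕜 := ℂ) B).restrictScalars ℝ).differentiable)

theorem expectation_phase (B : QuditOp N d) {c : ℂ} (hc : ‖c‖ = 1) (φ : QuditSpace N d) :
    expectation B (c • φ) = expectation B φ := by
  rw [expectation_eq_inner, expectation_eq_inner, map_smul, inner_smul_left, inner_smul_right,
    ← mul_assoc, Complex.conj_mul', hc]
  simp

theorem expectation_smul (c : ℂ) (B : QuditOp N d) (φ : QuditSpace N d) :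
    expectation (c • B) φ = c * expectation B φ := by
  rw [expectation, Matrix.smul_mulVec, dotProduct_smul]
  rfl

theorem expectation_one {φ : QuditSpace N d} (hφ : ‖φ‖ = 1) : expectation 1 φ = 1 := by
  rw [expectation_eq_inner, map_one, one_apply_eq_self, inner_self_eq_norm_sq_to_K, hφ]
  simp

theorem expectation_unitaryAction (B : QuditOp N d) (U : QuditUnitary N d) (φ : QuditSpace N d) :
    expectation B (unitaryAction U φ) =
      expectation (((U⁻¹ : QuditUnitary N d) : QuditOp N d) * B * (U : QuditOp N d)) φ := by
  rw [expectation, expectation, ofLp_unitaryAction, Matrix.star_mulVec, ← Matrix.dotProduct_mulVec,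
    Matrix.mulVec_mulVec, Matrix.mulVec_mulVec, Matrix.UnitaryGroup.inv_val,
    Matrix.star_eq_conjTranspose, Matrix.mul_assoc]

theorem trace_mul_pureState (B : QuditOp N d) (φ : QuditSpace N d) :
    (B * pureState φ).trace = expectation B φ := by
  rw [pureState, Matrix.mul_vecMulVec, Matrix.trace_vecMulVec, dotProduct_comm]
  rfl

/-- A family of operators whose expectation values have moduli that are permuted by the Clifford
group. -/
def IsCliffordPermuted {ι : Type*} (B : ι → QuditOp N d) : Prop :=
  ∀ g ∈ cliffordGroup N d, ∃ π : Equiv.Perm ι, ∀ i φ,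
    ‖expectation (B i) (unitaryAction g φ)‖ = ‖expectation (B (π i)) φ‖

/-- A sufficient condition for the moduli of expectation values to be permuted: conjugation by
Clifford unitaries permutes the operators up to phases. -/
theorem isCliffordPermuted_of_conj {ι : Type*} [Finite ι] {B : ι → QuditOp N d}
    (hB : ∀ g ∈ cliffordGroup N d, ∃ f : ι → ι, Function.Injective f ∧ ∀ i, ∃ c : ℂ, ‖c‖ = 1 ∧
      (g : QuditOp N d) * B i * ((g⁻¹ : QuditUnitary N d) : QuditOp N d) = c • B (f i)) :
    IsCliffordPermuted B := by
  intro g hg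
  -- The inverse appears because the expectation of B at gφ is that of g⁻¹Bg at φ.
  obtain ⟨f, hfinj, hf⟩ := hB g⁻¹ (inv_mem hg)
  refine ⟨Equiv.ofBijective f (Finite.injective_iff_bijective.1 hfinj), fun i φ => ?_⟩
  obtain ⟨c, hc, h⟩ := hf i
  rw [inv_inv] at h
  rw [expectation_unitaryAction, h, expectation_smul, norm_mul, hc, one_mul]
  rfl

theorem IsCliffordPermuted.const_smul {ι : Type*} {B : ι → QuditOp N d}
    (hB : IsCliffordPermuted B) (c : ℂ) : IsCliffordPermuted fun i => c • B i := by
  intro g hg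
  obtain ⟨π, hπ⟩ := hB g hg
  refine ⟨π, fun i φ => ?_⟩
  rw [expectation_smul, expectation_smul, norm_mul, norm_mul, hπ]

/-- Conjugation by a unitary. -/
def conjOp (g : QuditUnitary N d) : QuditOp N d →ₐ[ℂ] QuditOp N d :=
  (MulSemiringAction.toAlgHom ℂ (QuditOp N d) (ConjAct.toConjAct (Unitary.toUnits g)))

theorem conjOp_apply (g : QuditUnitary N d) (B : QuditOp N d) :
    conjOp g B = (g : QuditOp N d) * B * ((g⁻¹ : QuditUnitary N d) : QuditOp N d) :=
  rfl

theorem conjOp_injective (g : QuditUnitary N d) : Function.Injective (conjOp g) :=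
  MulAction.injective (ConjAct.toConjAct (Unitary.toUnits g))

end UnitaryAction

/-! ### Pauli operators and their permutation by Cliffords. -/

section Pauli

theorem omegaPow_injective : Function.Injective (omegaPow : ZMod d → ℂ) :=
  ZMod.injective_stdAddChar

theorem norm_omegaPow (x : ZMod d) : ‖omegaPow x‖ = 1 :=
  AddChar.norm_apply _ _

theorem omegaPow_ne_zero (x : ZMod d) : omegaPow x ≠ 0 :=
  norm_ne_zero_iff.1 (by rw [norm_omegaPow]; exact one_ne_zero)

theorem norm_eq_one_of_pow {c : ℂ} (hc : c ^ (2 * d) = 1) : ‖c‖ = 1 :=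
  Complex.norm_eq_one_of_pow_eq_one hc (mul_ne_zero two_ne_zero (Fact.out : d.Prime).ne_zero)

/-- Column 0 determines the shift and the scalar; the column of the k-th unit vector then determines
ω^(b k). -/
theorem pauliOp_eq_smul {c : ℂ} {a b a' b' : Fin N → ZMod d}
    (h : pauliOp a b = c • pauliOp a' b') : c = 1 ∧ a = a' ∧ b = b' := by
  have h0 := congrFun (congrFun h a) 0
  simp only [pauliOp, Matrix.of_apply, Matrix.smul_apply, add_zero, if_true, dotProduct_zero,
    omegaPow_zero, smul_eq_mul] at h0
  have ha : a = a' := by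
    by_contra hne
    simp [hne] at h0
  subst ha
  simp only [if_true, mul_one] at h0
  refine ⟨h0.symm, rfl, ?_⟩
  ext k
  have hk := congrFun (congrFun h (a + Pi.single k 1)) (Pi.single k 1)
  simp only [pauliOp, Matrix.of_apply, Matrix.smul_apply, if_true, ← h0, smul_eq_mul, one_mul,
    dotProduct_single, mul_one] at hk
  exact omegaPow_injective hk

theorem pauliOp_mem_unitaryGroup (a b : Fin N → ZMod d) :
    pauliOp a b ∈ Matrix.unitaryGroup (Fin N → ZMod d) ℂ := by
  rw [Matrix.mem_unitaryGroup_iff', star_pauliOp, smul_mul_assoc, pauliOp_mul, smul_smul,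
    ← omegaPow_add, neg_add_cancel, neg_add_cancel, pauliOp_zero, neg_dotProduct, add_neg_cancel,
    omegaPow_zero, one_smul]

/-- `X^a Z^b` as a unitary. -/
def pauliUnitary (a b : Fin N → ZMod d) : QuditUnitary N d :=
  ⟨pauliOp a b, pauliOp_mem_unitaryGroup a b⟩

theorem pauliUnitary_mem_pauliGroup (a b : Fin N → ZMod d) : pauliUnitary a b ∈ pauliGroup N d :=
  ⟨1, a, b, one_pow _, (one_smul _ _).symm⟩

theorem exists_conj_pauliOp {g : QuditUnitary N d} (hg : g ∈ cliffordGroup N d)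
    (χ : PhaseSpace N d) : ∃ (c : ℂ) (χ' : PhaseSpace N d), ‖c‖ = 1 ∧
      (g : QuditOp N d) * pauliOp χ.1 χ.2 * ((g⁻¹ : QuditUnitary N d) : QuditOp N d) =
        c • pauliOp χ'.1 χ'.2 := by
  obtain ⟨c, a, b, hc, h⟩ :=
    (Subgroup.mem_normalizer_iff.1 hg _).1 (pauliUnitary_mem_pauliGroup χ.1 χ.2)
  exact ⟨c, (a, b), norm_eq_one_of_pow hc, h⟩

theorem isCliffordPermuted_pauliOp :
    IsCliffordPermuted fun χ : PhaseSpace N d => pauliOp χ.1 χ.2 := by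
  refine isCliffordPermuted_of_conj fun g hg => ?_
  choose c f hc hf using exists_conj_pauliOp hg
  refine ⟨f, fun χ χ' h => ?_, fun χ => ⟨c χ, hc χ, hf χ⟩⟩
  have hne : c χ' ≠ 0 := norm_ne_zero_iff.1 (by rw [hc]; exact one_ne_zero)
  -- Two labels with the same image give proportional conjugates, hence proportional Pauli
  -- operators, hence equal labels.
  have h1 : conjOp g (pauliOp χ.1 χ.2) = conjOp g ((c χ * (c χ')⁻¹) • pauliOp χ'.1 χ'.2) := by
    rw [map_smul, conjOp_apply, conjOp_apply, hf, hf, h, smul_smul, mul_assoc,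
      inv_mul_cancel₀ hne, mul_one]
  have h2 := pauliOp_eq_smul (conjOp_injective g h1)
  exact Prod.ext h2.2.1 h2.2.2

end Pauli

/-! ### Phase-point operators and their permutation by Cliffords, for odd `d`. -/

section Wigner

theorem symplecticForm_comm (χ χ' : PhaseSpace N d) :
    symplecticForm χ' χ = -symplecticForm χ χ' := by
  simp only [symplecticForm, dotProduct_comm χ'.1, dotProduct_comm χ'.2]
  ring

theorem symplecticForm_add_right (χ η η' : PhaseSpace N d) :
    symplecticForm χ (η + η') = symplecticForm χ η + symplecticForm χ η' := by
  simp only [symplecticForm, Prod.fst_add, Prod.snd_add, dotProduct_add]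
  ring

/-- The additive character `η ↦ ω^{-⟨χ, η⟩}` of the phase space. -/
def symplecticChar (χ : PhaseSpace N d) : AddChar (PhaseSpace N d) ℂ where
  toFun η := omegaPow (-symplecticForm χ η)
  map_zero_eq_one' := by simp [symplecticForm, omegaPow_zero]
  map_add_eq_mul' η η' := by rw [symplecticForm_add_right, neg_add, omegaPow_add]

theorem symplecticChar_apply (χ η : PhaseSpace N d) :
    symplecticChar χ η = omegaPow (-symplecticForm χ η) :=
  rfl

theorem symplecticChar_injective :
    Function.Injective (symplecticChar : PhaseSpace N d → AddChar (PhaseSpace N d) ℂ) := by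
  intro χ χ' h
  have key : ∀ η, symplecticForm χ η = symplecticForm χ' η := fun η =>
    neg_injective (omegaPow_injective (DFunLike.congr_fun h η))
  apply Prod.ext <;> ext k
  · simpa [symplecticForm] using key (0, Pi.single k 1)
  · simpa [symplecticForm] using key (Pi.single k 1, 0)

/-- A finite abelian group has as many complex characters as elements. Surjectivity is the point: it
lets any character of phase space label a phase-point operator. -/
theorem symplecticChar_bijective :
    Function.Bijective (symplecticChar : PhaseSpace N d → AddChar (PhaseSpace N d) ℂ) :=
  (Fintype.bijective_iff_injective_and_card _).2 ⟨symplecticChar_injective, AddChar.card_eq.symm⟩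

theorem sum_symplecticChar (η : PhaseSpace N d) :
    ∑ χ : PhaseSpace N d, symplecticChar χ η = if η = 0 then ((d : ℂ) ^ N) ^ 2 else 0 := by
  have h : ∀ χ : PhaseSpace N d, symplecticChar χ η = symplecticChar (-η) χ := by
    intro χ
    rw [symplecticChar_apply, symplecticChar_apply, symplecticForm_comm]
    congr 1
    simp [symplecticForm]
    ring
  have h0 : symplecticChar (0 : PhaseSpace N d) = 0 := by
    ext χ
    simp [symplecticChar_apply, symplecticForm, omegaPow_zero]
  simp only [h]
  have hiff : symplecticChar (-η) = 0 ↔ η = 0 := by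
    rw [← h0, symplecticChar_injective.eq_iff, neg_eq_zero]
  rw [AddChar.sum_eq_ite]
  simp [hiff, sq, ZMod.card]

theorem phasePointOp_eq (χ : PhaseSpace N d) :
    phasePointOp χ = ((d : ℂ) ^ N)⁻¹ • ∑ η, symplecticChar χ η • displacementOp η :=
  rfl

theorem dim_ne_zero : ((d : ℂ) ^ N) ≠ 0 :=
  pow_ne_zero _ (Nat.cast_ne_zero.2 (Fact.out : d.Prime).ne_zero)

theorem displacementOp_zero : displacementOp (0 : PhaseSpace N d) = 1 := by
  simp [displacementOp, omegaPow_zero, pauliOp_zero]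

theorem sum_phasePointOp :
    ∑ χ : PhaseSpace N d, phasePointOp χ = ((d : ℂ) ^ N) • (1 : QuditOp N d) := by
  simp only [phasePointOp_eq]
  rw [← Finset.smul_sum, Finset.sum_comm]
  simp only [← Finset.sum_smul, sum_symplecticChar, ite_smul, zero_smul]
  rw [Finset.sum_ite_eq' Finset.univ 0]
  have := dim_ne_zero (N := N) (d := d)
  simp only [Finset.mem_univ, if_true, displacementOp_zero, smul_smul]
  congr 1
  field_simp

theorem displacementOp_eq_smul {c : ℂ} {χ χ' : PhaseSpace N d}
    (h : displacementOp χ = c • displacementOp χ') : c = 1 ∧ χ = χ' := by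
  have h1 : pauliOp χ.1 χ.2 = ((omegaPow (2⁻¹ * (χ.1 ⬝ᵥ χ.2)))⁻¹ * c *
      omegaPow (2⁻¹ * (χ'.1 ⬝ᵥ χ'.2))) • pauliOp χ'.1 χ'.2 := by
    rw [mul_assoc, mul_smul, mul_smul]
    exact (eq_inv_smul_iff₀ (omegaPow_ne_zero _)).2 h
  obtain ⟨h2, h3, h4⟩ := pauliOp_eq_smul h1
  have h5 : χ = χ' := Prod.ext h3 h4
  subst h5
  refine ⟨?_, rfl⟩
  rwa [mul_comm, mul_inv_cancel_left₀ (omegaPow_ne_zero _)] at h2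

theorem smul_displacementOp_eq {a b : ℂ} (ha : a ≠ 0) {χ χ' : PhaseSpace N d}
    (h : a • displacementOp χ = b • displacementOp χ') : a = b ∧ χ = χ' := by
  have h1 : displacementOp χ = (a⁻¹ * b) • displacementOp χ' := by
    rw [mul_smul]
    exact (eq_inv_smul_iff₀ ha).2 h
  obtain ⟨h2, h3⟩ := displacementOp_eq_smul h1
  exact ⟨by field_simp at h2; exact h2.symm, h3⟩

theorem two_ne_zero_of_ne_two (hd : d ≠ 2) : (2 : ZMod d) ≠ 0 := by
  intro h
  have h1 : ((2 : ℕ) : ZMod d) = 0 := by exact_mod_cast h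
  rw [ZMod.natCast_eq_zero_iff] at h1
  exact hd ((Nat.prime_dvd_prime_iff_eq Fact.out Nat.prime_two).1 h1)

/-- The normalization ω^(p·q/2) makes the multiplication phase depend on the symplectic form alone;
this needs 2 to be invertible. -/
theorem displacementOp_mul (hd : d ≠ 2) (χ χ' : PhaseSpace N d) :
    displacementOp χ * displacementOp χ' =
      omegaPow (-(2⁻¹ * symplecticForm χ χ')) • displacementOp (χ + χ') := by
  have h2 := two_ne_zero_of_ne_two hd
  simp only [displacementOp, smul_mul_smul_comm, pauliOp_mul, smul_smul, ← omegaPow_add,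
    Prod.fst_add, Prod.snd_add]
  congr 2
  simp only [symplecticForm, add_dotProduct, dotProduct_add, dotProduct_comm χ'.1 χ.2]
  linear_combination -(χ.2 ⬝ᵥ χ'.1) * inv_mul_cancel₀ h2

theorem displacementOp_mul_comm (hd : d ≠ 2) (χ χ' : PhaseSpace N d) :
    displacementOp χ * displacementOp χ' =
      omegaPow (-symplecticForm χ χ') • (displacementOp χ' * displacementOp χ) := by
  have h2 := two_ne_zero_of_ne_two hd
  rw [displacementOp_mul hd, displacementOp_mul hd, smul_smul, ← omegaPow_add, add_comm χ',
    symplecticForm_comm χ χ']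
  congr 2
  field_simp
  ring

theorem exists_conj_displacementOp {g : QuditUnitary N d} (hg : g ∈ cliffordGroup N d)
    (χ : PhaseSpace N d) : ∃ (c : ℂ) (χ' : PhaseSpace N d), c ≠ 0 ∧
      conjOp g (displacementOp χ) = c • displacementOp χ' := by
  obtain ⟨c, χ', hc, h⟩ := exists_conj_pauliOp hg χ
  rw [← conjOp_apply] at h
  have hc0 : c ≠ 0 := norm_ne_zero_iff.1 (by rw [hc]; exact one_ne_zero)
  refine ⟨omegaPow (2⁻¹ * (χ.1 ⬝ᵥ χ.2)) * c * (omegaPow (2⁻¹ * (χ'.1 ⬝ᵥ χ'.2)))⁻¹, χ',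
    mul_ne_zero (mul_ne_zero (omegaPow_ne_zero _) hc0) (inv_ne_zero (omegaPow_ne_zero _)), ?_⟩
  rw [displacementOp, map_smul, h, displacementOp, smul_smul, smul_smul,
    inv_mul_cancel_right₀ (omegaPow_ne_zero _)]

/-- Clifford unitaries act on displacement operators by a symplectic automorphism of the phase space
and an additive character. -/
theorem exists_conj_displacementOp_addEquiv (hd : d ≠ 2) {g : QuditUnitary N d}
    (hg : g ∈ cliffordGroup N d) :
    ∃ (c : AddChar (PhaseSpace N d) ℂ) (σ : PhaseSpace N d ≃+ PhaseSpace N d),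
      ∀ χ, conjOp g (displacementOp χ) = c χ • displacementOp (σ χ) := by
  choose c σ hc hσ using exists_conj_displacementOp hg
  -- Conjugation preserves commutation phases, which are given by the symplectic form.
  have hsymp : ∀ χ χ', symplecticForm (σ χ) (σ χ') = symplecticForm χ χ' := by
    intro χ χ'
    have h := congrArg (conjOp g) (displacementOp_mul_comm hd χ χ')
    rw [map_smul, map_mul, map_mul, hσ, hσ, smul_mul_smul_comm, smul_mul_smul_comm,
      displacementOp_mul_comm hd, displacementOp_mul hd (σ χ'), smul_smul, smul_smul, smul_smul,
      smul_smul] at h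
    obtain ⟨h1, -⟩ := smul_displacementOp_eq (mul_ne_zero
      (mul_ne_zero (mul_ne_zero (hc _) (hc _)) (omegaPow_ne_zero _)) (omegaPow_ne_zero _)) h
    have h2 := mul_right_cancel₀ (omegaPow_ne_zero _) h1
    rw [mul_comm, mul_comm (c χ')] at h2
    exact neg_injective (omegaPow_injective
      (mul_right_cancel₀ (mul_ne_zero (hc χ) (hc χ')) h2))
  -- Since `σ` preserves the form, the phases in the product rule agree on both sides and cancel,
  -- leaving additivity.
  have hadd : ∀ χ χ', c (χ + χ') = c χ * c χ' ∧ σ (χ + χ') = σ χ + σ χ' := by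
    intro χ χ'
    refine smul_displacementOp_eq (hc _) ?_
    have h := congrArg (conjOp g) (displacementOp_mul hd χ χ')
    rw [map_smul, map_mul, hσ, hσ, hσ, smul_mul_smul_comm, displacementOp_mul hd, hsymp, smul_comm]
      at h
    exact (smul_right_injective _ (omegaPow_ne_zero _) h).symm
  have hinj : Function.Injective σ := by
    intro χ χ' h
    apply symplecticChar_injective
    ext η
    rw [symplecticChar_apply, symplecticChar_apply, ← hsymp, h, hsymp]
  refine ⟨{ toFun := c
            map_zero_eq_one' := ?_
            map_add_eq_mul' := fun χ χ' => (hadd χ χ').1 },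
    { Equiv.ofBijective σ (Finite.injective_iff_bijective.1 hinj) with
      map_add' := fun χ χ' => (hadd χ χ').2 }, hσ⟩
  have h := (hadd 0 0).1
  rw [add_zero] at h
  exact (mul_eq_left₀ (hc 0)).1 h.symm

/-- A phase-point operator is a Fourier sum of displacements. Conjugation relabels them by `σ` and
twists the coefficients by the character `c`; the new coefficients again form a character, so the
result is exactly another phase-point operator, with no extra phase. -/
theorem isCliffordPermuted_phasePointOp (hd : d ≠ 2) :
    IsCliffordPermuted (phasePointOp : PhaseSpace N d → QuditOp N d) := by
  refine isCliffordPermuted_of_conj fun g hg => ?_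
  obtain ⟨c, σ, h⟩ := exists_conj_displacementOp_addEquiv hd hg
  choose f hf using fun χ : PhaseSpace N d =>
    symplecticChar_bijective.2 ((symplecticChar χ * c).compAddMonoidHom σ.symm.toAddMonoidHom)
  have hf' : ∀ χ η, symplecticChar (f χ) (σ η) = symplecticChar χ η * c η := by
    intro χ η
    rw [hf]
    simp
  refine ⟨f, fun χ χ' hχ => ?_, fun χ => ⟨1, norm_one, ?_⟩⟩
  · apply symplecticChar_injective
    ext η
    have h1 := hf' χ η
    rw [hχ, hf'] at h1
    exact (mul_right_cancel₀ (norm_ne_zero_iff.1 (by rw [c.norm_apply]; exact one_ne_zero)) h1).symm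
  · rw [one_smul, ← conjOp_apply, phasePointOp_eq, phasePointOp_eq, map_smul, map_sum]
    congr 1
    refine Fintype.sum_equiv σ.toEquiv _ _ fun η => ?_
    rw [map_smul, h, smul_smul, ← hf']
    rfl

theorem wigner_pureState (χ : PhaseSpace N d) (φ : QuditSpace N d) :
    wigner χ (pureState φ) = expectation (((d : ℂ) ^ N)⁻¹ • phasePointOp χ) φ := by
  rw [wigner, trace_mul_pureState, expectation_smul]

theorem sum_wigner_pureState {φ : QuditSpace N d} (hφ : ‖φ‖ = 1) :
    ∑ χ, wigner χ (pureState φ) = 1 := by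
  simp only [wigner]
  rw [← Finset.mul_sum, ← Matrix.trace_sum, ← Finset.sum_mul, sum_phasePointOp, smul_mul_assoc,
    one_mul, Matrix.trace_smul, smul_eq_mul, inv_mul_cancel_left₀ dim_ne_zero,
    ← one_mul (pureState φ), trace_mul_pureState, expectation_one hφ]

/-- The Wigner values sum to 1, so the argument of the logarithm in the mana is at least 1. -/
theorem sum_norm_wigner_pos {φ : QuditSpace N d} (hφ : ‖φ‖ = 1) :
    0 < ∑ χ, ‖wigner χ (pureState φ)‖ := by
  have h := norm_sum_le Finset.univ fun χ => wigner χ (pureState φ)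
  rw [sum_wigner_pureState hφ, norm_one] at h
  linarith

end Wigner

/-! ### Extremality of mana and Rényi entropy. -/

section CliffordStabilizer

/-- A Clifford-stabilizer state, presented through the action of its stabilizing group. -/
theorem IsCliffordStabilizerState.exists_action {ψ : QuditSpace N d}
    (hψ : IsCliffordStabilizerState ψ) :
    ∃ Q : Subgroup (QuditUnitary N d), Q ≤ cliffordGroup N d ∧ Finite Q ∧
      (∀ g : Q, (unitaryAction.comp Q.subtype) g ψ = ψ) ∧
      ∀ v, (∀ g : Q, (unitaryAction.comp Q.subtype) g v = v) → v ∈ Submodule.span ℂ {ψ} := by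
  obtain ⟨-, Q, hQ, hfin, hspan⟩ := hψ
  refine ⟨Q, hQ, hfin, fun g => ?_, fun v hv => ?_⟩
  · have h : ψ ∈ stabilizedSpace Q := hspan ▸ Submodule.mem_span_singleton_self ψ
    exact mem_stabilizedSpace.1 h g g.2
  · rw [← hspan]
    exact mem_stabilizedSpace.2 fun g hg => hv ⟨g, hg⟩

/-- Clifford-invariant, phase-invariant differentiable functions are critical at
Clifford-stabilizer states. -/
theorem IsCliffordStabilizerState.hasDerivAt_zero {ψ : QuditSpace N d}
    (hψ : IsCliffordStabilizerState ψ) {γ : ℝ → QuditSpace N d} (hγ : DifferentiableAt ℝ γ 0)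
    (hnorm : ∀ t, ‖γ t‖ = 1) (hγ0 : γ 0 = ψ) {p : QuditSpace N d → ℝ}
    (hp : DifferentiableAt ℝ p ψ) (hphase : ∀ (c : ℂ) φ, ‖c‖ = 1 → p (c • φ) = p φ)
    (hinv : ∀ g ∈ cliffordGroup N d, unitaryAction g ψ = ψ →
      ∀ φ, p (unitaryAction g φ) = p φ) :
    HasDerivAt (fun t => p (γ t)) 0 0 := by
  obtain ⟨Q, hQ, hfin, hfix, hspan⟩ := hψ.exists_action
  have := Fintype.ofFinite Q
  exact hasDerivAt_zero_of_invariant (unitaryAction.comp Q.subtype) hfix hspan hγ hnorm hγ0 hp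
    hphase fun g => hinv g (hQ g.2) (hfix g)

theorem IsCliffordStabilizerState.isExtremalOnPureStates_sum_norm {ψ : QuditSpace N d}
    (hψ : IsCliffordStabilizerState ψ) {ι : Type*} [Fintype ι] {B : ι → QuditOp N d}
    (hB : IsCliffordPermuted B) :
    IsExtremalOnPureStates (fun φ => ∑ i, ‖expectation (B i) φ‖) ψ := by
  classical
  intro γ hγ hnorm hγ0
  have hγd : DifferentiableAt ℝ γ 0 := hγ.differentiable (by simp) 0
  have hd : ∀ i, DifferentiableAt ℝ (fun t => expectation (B i) (γ t)) 0 := fun i =>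
    (differentiable_expectation (B i) (γ 0)).comp 0 hγd
  refine isExtremalPoint_of_eq_add_sum_norm
    (Finset.univ.filter fun i => ¬ expectation (B i) ψ ≠ 0)
    (G := fun t => ∑ i with expectation (B i) ψ ≠ 0, ‖expectation (B i) (γ t)‖)
    (u := fun i t => expectation (B i) (γ t))
    (u' := fun i => deriv (fun t => expectation (B i) (γ t)) 0) ?_ ?_
    (fun i _ => (hd i).hasDerivAt) (fun i hi => ?_)
    (fun t => (Finset.sum_filter_add_sum_filter_not _ _ _).symm)
  · exact continuous_finsetSum _ fun i _ =>
      ((differentiable_expectation (B i)).continuous.comp hγ.continuous).norm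
  · refine hψ.hasDerivAt_zero hγd hnorm hγ0
      (p := fun φ => ∑ i with expectation (B i) ψ ≠ 0, ‖expectation (B i) φ‖) ?_ ?_ ?_
    · exact DifferentiableAt.fun_sum fun i hi =>
        (differentiable_expectation (B i) ψ).norm ℂ (Finset.mem_filter.1 hi).2
    · intro c φ hc
      simp only [expectation_phase _ hc]
    · intro g hg hgψ φ
      obtain ⟨π, hπ⟩ := hB g hg
      simp only [hπ]
      refine Finset.sum_equiv π (fun i => ?_) fun i _ => rfl
      -- Evaluating at the fixed point ψ shows that `π` preserves the set of operators with nonzero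
      -- expectation at ψ.
      have h := hπ i ψ
      rw [hgψ] at h
      rw [Finset.mem_filter_univ, Finset.mem_filter_univ, ← norm_ne_zero_iff, h,
        norm_ne_zero_iff]
  · simpa [hγ0] using hi

theorem IsCliffordStabilizerState.isExtremalOnPureStates_mana {ψ : QuditSpace N d}
    (hψ : IsCliffordStabilizerState ψ) (hd : d ≠ 2) :
    IsExtremalOnPureStates (fun φ => mana (pureState φ)) ψ := by
  intro γ hγ hnorm hγ0
  have h := hψ.isExtremalOnPureStates_sum_norm
    ((isCliffordPermuted_phasePointOp hd).const_smul ((d : ℂ) ^ N)⁻¹) γ hγ hnorm hγ0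
  simp only [← wigner_pureState] at h
  exact h.log fun t => sum_norm_wigner_pos (hnorm t)

theorem pauliProb_eq (χ : PhaseSpace N d) (φ : QuditSpace N d) :
    pauliProb χ φ = ((d : ℝ) ^ N)⁻¹ * ‖expectation (pauliOp χ.1 χ.2) φ‖ ^ 2 :=
  rfl

theorem pauliProb_nonneg (χ : PhaseSpace N d) (φ : QuditSpace N d) : 0 ≤ pauliProb χ φ := by
  rw [pauliProb_eq]
  positivity

/-- The bound on `α` makes x ↦ x^α differentiable even at 0, where Pauli probabilities may vanish.
-/
theorem differentiable_sum_pauliProb_rpow {α : ℝ} (hα : 1 ≤ α) :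
    Differentiable ℝ fun φ : QuditSpace N d => ∑ χ : PhaseSpace N d, pauliProb χ φ ^ α :=
  Differentiable.fun_sum fun _ _ => Differentiable.rpow_const
    (((differentiable_expectation _).norm_sq ℂ).const_mul _) fun _ => Or.inr hα

theorem sum_pauliProb_rpow_pos (α : ℝ) {φ : QuditSpace N d} (hφ : ‖φ‖ = 1) :
    0 < ∑ χ : PhaseSpace N d, pauliProb χ φ ^ α := by
  refine Finset.sum_pos' (fun χ _ => Real.rpow_nonneg (pauliProb_nonneg χ φ) α)
    ⟨0, Finset.mem_univ _, Real.rpow_pos_of_pos ?_ α⟩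
  have hd : (0 : ℝ) < d := Nat.cast_pos.2 (Fact.out : d.Prime).pos
  rw [pauliProb_eq, Prod.fst_zero, Prod.snd_zero, pauliOp_zero, expectation_one hφ]
  simp only [norm_one]
  positivity

theorem IsCliffordStabilizerState.isExtremalOnPureStates_stabilizerRenyiEntropy
    {ψ : QuditSpace N d} (hψ : IsCliffordStabilizerState ψ) {α : ℝ} (hα : 1 ≤ α) :
    IsExtremalOnPureStates (stabilizerRenyiEntropy α) ψ := by
  intro γ hγ hnorm hγ0
  have hd : (0 : ℝ) < d := Nat.cast_pos.2 (Fact.out : d.Prime).pos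
  have hne : ∀ t, 1 / (d : ℝ) ^ ((1 - α) * (N : ℝ)) *
      ∑ χ : PhaseSpace N d, pauliProb χ (γ t) ^ α ≠ 0 := fun t =>
    (mul_pos (by positivity) (sum_pauliProb_rpow_pos α (hnorm t))).ne'
  refine ⟨?_, Or.inl ?_⟩
  · exact continuous_const.mul ((continuous_const.mul
      ((differentiable_sum_pauliProb_rpow hα).continuous.comp hγ.continuous)).log hne)
  · have h : HasDerivAt (fun t => ∑ χ : PhaseSpace N d, pauliProb χ (γ t) ^ α) 0 0 := by
      refine hψ.hasDerivAt_zero (hγ.differentiable (by simp) 0) hnorm hγ0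
        (p := fun φ => ∑ χ : PhaseSpace N d, pauliProb χ φ ^ α)
        (differentiable_sum_pauliProb_rpow hα ψ) ?_ ?_
      · intro c φ hc
        simp only [pauliProb_eq, expectation_phase _ hc]
      · intro g hg _ φ
        obtain ⟨π, hπ⟩ := isCliffordPermuted_pauliOp g hg
        simp only [pauliProb_eq, hπ]
        exact Equiv.sum_comp π fun χ : PhaseSpace N d =>
          (((d : ℝ) ^ N)⁻¹ * ‖expectation (pauliOp χ.1 χ.2) φ‖ ^ 2) ^ α
    have h2 := ((h.const_mul (1 / (d : ℝ) ^ ((1 - α) * (N : ℝ)))).log (hne 0)).const_mul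
      (1 / (1 - α))
    rwa [mul_zero, zero_div, mul_zero] at h2

end CliffordStabilizer

/-! ### Stabilizer fidelity as a finite maximum of projection weights. -/

section StabilizerFidelity

variable (N d) in
/-- The abelian subgroups of order `d^N` of the generalized Pauli group. -/
abbrev StabilizerGroup : Type :=
  {S : Subgroup (QuditUnitary N d) //
    S ≤ pauliGroup N d ∧ (∀ g ∈ S, ∀ h ∈ S, g * h = h * g) ∧ Nat.card S = d ^ N}

theorem finite_pauliGroup : (pauliGroup N d : Set (QuditUnitary N d)).Finite := by
  have hroots : Finite {c : ℂ // c ^ (2 * d) = 1} := by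
    have hpos : 0 < 2 * d := Nat.mul_pos two_pos (Fact.out : d.Prime).pos
    refine (((Polynomial.nthRoots (2 * d) (1 : ℂ)).toFinset.finite_toSet).subset
      fun c hc => ?_ : {c : ℂ | c ^ (2 * d) = 1}.Finite)
    simpa [Polynomial.mem_nthRoots hpos] using hc
  have hex : ∀ U : pauliGroup N d, ∃ x : {c : ℂ // c ^ (2 * d) = 1} × PhaseSpace N d,
      (U : QuditOp N d) = x.1.1 • pauliOp x.2.1 x.2.2 := by
    rintro ⟨U, c, a, b, hc, hU⟩
    exact ⟨(⟨c, hc⟩, a, b), hU⟩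
  choose f hf using hex
  have : Finite (pauliGroup N d) := Finite.of_injective f fun U V h =>
    Subtype.ext (Subtype.ext (by rw [hf, hf, h]))
  exact Set.toFinite _

instance : Finite (StabilizerGroup N d) := by
  have : Finite {s : Set (QuditUnitary N d) // s ⊆ pauliGroup N d} :=
    finite_pauliGroup.finite_subsets
  exact Finite.of_injective
    (fun S : StabilizerGroup N d =>
      (⟨S.1, S.2.1⟩ : {s : Set (QuditUnitary N d) // s ⊆ pauliGroup N d}))
    fun S T h => Subtype.ext (SetLike.coe_injective (congrArg Subtype.val h))

/-- The squared norm of the projection to the stabilized space of a stabilizer group. -/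
def stabilizerWeight (S : StabilizerGroup N d) (φ : QuditSpace N d) : ℝ :=
  ‖(stabilizedSpace S.1).starProjection φ‖ ^ 2

theorem differentiable_stabilizerWeight (S : StabilizerGroup N d) :
    Differentiable ℝ (stabilizerWeight S) :=
  (((stabilizedSpace S.1).starProjection.restrictScalars ℝ).differentiable).norm_sq ℂ

theorem stabilizerWeight_phase (S : StabilizerGroup N d) {c : ℂ} (hc : ‖c‖ = 1)
    (φ : QuditSpace N d) : stabilizerWeight S (c • φ) = stabilizerWeight S φ := by
  rw [stabilizerWeight, map_smul, norm_smul, hc, one_mul, stabilizerWeight]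

/-- The projection is self-adjoint and fixes s, so φ may be replaced by its projection; then
Cauchy–Schwarz applies. -/
theorem norm_inner_sq_le_stabilizerWeight (S : StabilizerGroup N d) (φ : QuditSpace N d)
    {s : QuditSpace N d} (hs : s ∈ stabilizedSpace S.1) (hs1 : ‖s‖ = 1) :
    ‖inner ℂ φ s‖ ^ 2 ≤ stabilizerWeight S φ := by
  rw [stabilizerWeight, ← Submodule.starProjection_eq_self_iff.2 hs,
    ← Submodule.inner_starProjection_left_eq_right]
  have h := norm_inner_le_norm (𝕜 := ℂ) ((stabilizedSpace S.1).starProjection φ) s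
  rw [hs1, mul_one] at h
  gcongr

/-- Conjugation of stabilizer groups by a Clifford unitary. -/
def StabilizerGroup.conj (g : QuditUnitary N d) (hg : g ∈ cliffordGroup N d)
    (S : StabilizerGroup N d) : StabilizerGroup N d :=
  ⟨S.1.map (MulAut.conj g).toMonoidHom, by
    refine ⟨?_, ?_, ?_⟩
    · rintro _ ⟨h, hh, rfl⟩
      exact (Subgroup.mem_normalizer_iff.1 hg h).1 (S.2.1 hh)
    · rintro _ ⟨h, hh, rfl⟩ _ ⟨k, hk, rfl⟩
      rw [← map_mul, ← map_mul, S.2.2.1 h hh k hk]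
    · exact (Nat.card_congr
        (S.1.equivMapOfInjective _ (MulAut.conj g).injective).toEquiv).symm.trans S.2.2.2⟩

theorem StabilizerGroup.stabilizedSpace_conj {g : QuditUnitary N d} (hg : g ∈ cliffordGroup N d)
    (S : StabilizerGroup N d) :
    stabilizedSpace (S.conj g hg).1 =
      (stabilizedSpace S.1).map ((unitaryAction g).toLinearEquiv : _ →ₗ[ℂ] QuditSpace N d) := by
  ext φ
  rw [Submodule.mem_map]
  simp only [mem_stabilizedSpace]
  constructor
  · intro h
    refine ⟨unitaryAction g⁻¹ φ, fun k hk => ?_, ?_⟩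
    · have h1 := h _ ⟨k, hk, rfl⟩
      have h2 := congrArg (unitaryAction g⁻¹) h1
      simpa [map_mul, map_inv] using h2
    · simp [map_inv]
  · rintro ⟨v, hv, rfl⟩ _ ⟨k, hk, rfl⟩
    have := hv k hk
    simp [map_mul, map_inv, this]

/-- The space of g⁻¹Sg is the image under g⁻¹ of that of S, so the two projections are conjugate by
an isometry. -/
theorem stabilizerWeight_unitaryAction {g : QuditUnitary N d} (hg : g ∈ cliffordGroup N d)
    (S : StabilizerGroup N d) (φ : QuditSpace N d) :
    stabilizerWeight S (unitaryAction g φ) =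
      stabilizerWeight (S.conj g⁻¹ (inv_mem hg)) φ := by
  have key : ∀ V W : Submodule ℂ (QuditSpace N d), V = W →
      V.starProjection φ = W.starProjection φ := by
    rintro _ _ rfl
    rfl
  rw [stabilizerWeight, stabilizerWeight, key _ _ (S.stabilizedSpace_conj (inv_mem hg)),
    Submodule.starProjection_map_apply, LinearIsometryEquiv.norm_map, map_inv]
  rfl

theorem isStabilizerState_iff {s : QuditSpace N d} :
    IsStabilizerState s ↔ ‖s‖ = 1 ∧ ∃ S : StabilizerGroup N d, s ∈ stabilizedSpace S.1 :=
  and_congr_right fun _ =>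
    ⟨fun ⟨S, h1, h2, h3, h4⟩ => ⟨⟨S, h1, h2, h3⟩, h4⟩,
      fun ⟨S, h⟩ => ⟨S.1, S.2.1, S.2.2.1, S.2.2.2, h⟩⟩

variable (N d) in
/-- The Pauli operators `Z^b`, as a homomorphism. -/
def pauliZHom : Multiplicative (Fin N → ZMod d) →* QuditUnitary N d where
  toFun b := pauliUnitary 0 b.toAdd
  map_one' := Subtype.ext pauliOp_zero
  map_mul' b b' := Subtype.ext (by
    simp [pauliUnitary, pauliOp_mul, omegaPow_zero])

theorem pauliZHom_injective : Function.Injective (pauliZHom N d) := by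
  intro b b' h
  have h1 : pauliOp 0 b.toAdd = (1 : ℂ) • pauliOp 0 b'.toAdd := by
    rw [one_smul]
    exact congrArg Subtype.val h
  exact (pauliOp_eq_smul h1).2.2

variable (N d) in
/-- The stabilizer group of all `Z^b`. -/
def zStabilizerGroup : StabilizerGroup N d :=
  ⟨(pauliZHom N d).range, by
    refine ⟨?_, ?_, ?_⟩
    · rintro _ ⟨b, rfl⟩
      exact pauliUnitary_mem_pauliGroup _ _
    · rintro _ ⟨b, rfl⟩ _ ⟨b', rfl⟩
      rw [← map_mul, mul_comm, map_mul]
    · rw [← Nat.card_congr (MonoidHom.ofInjective pauliZHom_injective).toEquiv]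
      simp [Nat.card_eq_fintype_card, ZMod.card]⟩

instance : Nonempty (StabilizerGroup N d) :=
  ⟨zStabilizerGroup N d⟩

/-- |0⟩ is fixed by every Z^b and |j⟩ = X^j|0⟩. Some basis state overlaps any given nonzero vector,
which makes the fidelity positive. -/
theorem single_mem_stabilizedSpace (j : Fin N → ZMod d) :
    ∃ S : StabilizerGroup N d, EuclideanSpace.single j (1 : ℂ) ∈ stabilizedSpace S.1 := by
  have hX : pauliUnitary j (0 : Fin N → ZMod d) ∈ cliffordGroup N d :=
    Subgroup.le_normalizer (pauliUnitary_mem_pauliGroup j 0)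
  refine ⟨(zStabilizerGroup N d).conj _ hX, ?_⟩
  rw [StabilizerGroup.stabilizedSpace_conj]
  refine ⟨EuclideanSpace.single 0 1, ?_, ?_⟩
  · rintro _ ⟨b, rfl⟩
    change pauliOp 0 b.toAdd *ᵥ Pi.single 0 1 = Pi.single 0 1
    ext i
    simp [pauliOp, omegaPow_zero, Pi.single_apply]
  · apply WithLp.ofLp_injective
    change pauliOp j 0 *ᵥ Pi.single 0 1 = Pi.single j 1
    ext i
    simp [pauliOp, omegaPow_zero, Pi.single_apply]

/-- The best overlap of φ with unit vectors of a subspace is the norm of its projection, attained at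
the normalized projection when that is nonzero. The dimension of the stabilized spaces is never
needed. -/
theorem stabilizerFidelity_eq (φ : QuditSpace N d) :
    stabilizerFidelity φ = ⨆ S : StabilizerGroup N d, stabilizerWeight S φ := by
  have hbdd : BddAbove (Set.range fun S : StabilizerGroup N d => stabilizerWeight S φ) :=
    (Set.finite_range _).bddAbove
  have hle : ∀ s : {s : QuditSpace N d // IsStabilizerState s},
      ‖inner ℂ φ s.1‖ ^ 2 ≤ ⨆ S : StabilizerGroup N d, stabilizerWeight S φ := by
    rintro ⟨s, hs⟩
    obtain ⟨hs1, S, hS⟩ := isStabilizerState_iff.1 hs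
    exact (norm_inner_sq_le_stabilizerWeight S φ hS hs1).trans (le_ciSup hbdd S)
  -- `Real.iSup_le` takes a nonnegative bound, so the set of stabilizer states need not be known to
  -- be nonempty.
  refine le_antisymm (Real.iSup_le hle (Real.iSup_nonneg fun S => sq_nonneg _))
    (ciSup_le fun S => ?_)
  rw [stabilizerWeight]
  set v := (stabilizedSpace S.1).starProjection φ with hv
  by_cases h0 : v = 0
  · rw [h0, norm_zero]
    exact (zero_pow two_ne_zero).trans_le (Real.iSup_nonneg fun s => sq_nonneg _)
  have hvn : ‖v‖ ≠ 0 := norm_ne_zero_iff.2 h0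
  have hvS : v ∈ stabilizedSpace S.1 := Submodule.starProjection_apply_mem _ _
  have hs : IsStabilizerState (((‖v‖⁻¹ : ℝ) : ℂ) • v) := by
    refine isStabilizerState_iff.2 ⟨?_, S, Submodule.smul_mem _ _ hvS⟩
    rw [norm_smul, Complex.norm_real, norm_inv, norm_norm, inv_mul_cancel₀ hvn]
  have hin : ‖inner ℂ φ (((‖v‖⁻¹ : ℝ) : ℂ) • v)‖ = ‖v‖ := by
    have h1 : inner ℂ φ v = inner ℂ v v := by
      nth_rw 1 [← Submodule.starProjection_eq_self_iff.2 hvS]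
      rw [← Submodule.inner_starProjection_left_eq_right]
    rw [inner_smul_right, h1, norm_mul, Complex.norm_real, norm_inv, norm_norm,
      inner_self_eq_norm_sq_to_K, norm_pow, RCLike.norm_ofReal, abs_norm, sq,
      inv_mul_cancel_left₀ hvn]
  have h := le_ciSup (f := fun s : {s : QuditSpace N d // IsStabilizerState s} =>
    ‖inner ℂ φ s.1‖ ^ 2) ⟨_, by rintro _ ⟨s, rfl⟩; exact hle s⟩ ⟨_, hs⟩
  simp only [hin] at h
  exact h

theorem stabilizerFidelity_pos {φ : QuditSpace N d} (hφ : ‖φ‖ = 1) :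
    0 < stabilizerFidelity φ := by
  have hne : φ ≠ 0 := norm_ne_zero_iff.1 (by rw [hφ]; exact one_ne_zero)
  obtain ⟨j, hj⟩ : ∃ j, φ j ≠ 0 := by
    by_contra! h
    exact hne (PiLp.ext h)
  obtain ⟨S, hS⟩ := single_mem_stabilizedSpace j
  rw [stabilizerFidelity_eq]
  have h1 := norm_inner_sq_le_stabilizerWeight S φ hS (by simp)
  have h2 : stabilizerWeight S φ ≤ ⨆ S : StabilizerGroup N d, stabilizerWeight S φ :=
    le_ciSup (f := fun S : StabilizerGroup N d => stabilizerWeight S φ)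
      (Set.finite_range _).bddAbove S
  refine lt_of_lt_of_le ?_ (h1.trans h2)
  rw [EuclideanSpace.inner_single_right]
  simpa using pow_pos (norm_pos_iff.2 hj) 2

theorem IsCliffordStabilizerState.isExtremalOnPureStates_stabilizerFidelity
    {ψ : QuditSpace N d} (hψ : IsCliffordStabilizerState ψ) :
    IsExtremalOnPureStates stabilizerFidelity ψ := by
  intro γ hγ hnorm hγ0
  simp only [stabilizerFidelity_eq]
  have hγd : Differentiable ℝ γ := hγ.differentiable (by simp)
  have hd : ∀ S : StabilizerGroup N d, Differentiable ℝ fun t => stabilizerWeight S (γ t) :=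
    fun S => (differentiable_stabilizerWeight S).comp hγd
  refine isExtremalPoint_iSup (fun S => (hd S).continuous) (fun S => (hd S 0).hasDerivAt)
    fun S _ hS => ?_
  obtain ⟨Q, hQ, hfin, hfix, hspan⟩ := hψ.exists_action
  have := Fintype.ofFinite Q
  obtain ⟨p', hp', hsum⟩ := exists_hasDerivAt_sum_eq_zero (unitaryAction.comp Q.subtype) hfix hspan
    (hγd 0) hnorm hγ0 (differentiable_stabilizerWeight S ψ)
    fun c φ hc => stabilizerWeight_phase S hc φ
  -- Moving the curve by g amounts to conjugating `S`; since g fixes ψ, the conjugate ties with `S`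
  -- at ψ and has slope `p' g`.
  have horbit : ∀ g : Q, ∃ T : StabilizerGroup N d,
      stabilizerWeight T (γ 0) = stabilizerWeight S (γ 0) ∧
        deriv (fun t => stabilizerWeight T (γ t)) 0 = p' g := by
    intro g
    have hw : ∀ φ, stabilizerWeight S ((unitaryAction.comp Q.subtype) g φ) =
        stabilizerWeight (S.conj _ (inv_mem (hQ g.2))) φ :=
      stabilizerWeight_unitaryAction (hQ g.2) S
    refine ⟨S.conj _ (inv_mem (hQ g.2)), ?_, ?_⟩
    · rw [← hw, hγ0, hfix]
    · simp only [← hw]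
      exact (hp' g).deriv
  -- The identity gives the slope of `S` itself, so the zero-sum family `p'` is not identically zero
  -- and takes both signs.
  have hone : p' 1 ≠ 0 := by
    have h1 := hp' 1
    rw [map_one] at h1
    rw [← h1.deriv]
    exact hS
  constructor
  · obtain ⟨g, -, hg⟩ :=
      Finset.exists_pos_of_sum_zero_of_exists_nonzero p' hsum ⟨1, Finset.mem_univ _, hone⟩
    obtain ⟨T, hT0, hT⟩ := horbit g
    exact ⟨T, hT0, hT ▸ hg⟩
  · obtain ⟨g, -, hg⟩ := Finset.exists_pos_of_sum_zero_of_exists_nonzero (fun g => -p' g)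
      (by rw [Finset.sum_neg_distrib, hsum, neg_zero])
      ⟨1, Finset.mem_univ _, neg_ne_zero.2 hone⟩
    obtain ⟨T, hT0, hT⟩ := horbit g
    exact ⟨T, hT0, hT ▸ neg_pos.1 hg⟩

theorem IsCliffordStabilizerState.isExtremalOnPureStates_minRelativeEntropyOfMagic
    {ψ : QuditSpace N d} (hψ : IsCliffordStabilizerState ψ) :
    IsExtremalOnPureStates minRelativeEntropyOfMagic ψ := fun γ hγ hnorm hγ0 =>
  ((hψ.isExtremalOnPureStates_stabilizerFidelity γ hγ hnorm hγ0).log fun t =>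
    stabilizerFidelity_pos (hnorm t)).neg

end StabilizerFidelity

end QuditMagic

end

theorem mainTheorem3 (N d : ℕ) [Fact d.Prime] (ψ : QuditMagic.QuditSpace N d)
    (hψ : QuditMagic.IsCliffordStabilizerState ψ) :
    (d ≠ 2 → QuditMagic.IsExtremalOnPureStates
      (fun φ => QuditMagic.mana (QuditMagic.pureState φ)) ψ) ∧
    (∀ α : ℝ, 2 ≤ α →
      QuditMagic.IsExtremalOnPureStates (QuditMagic.stabilizerRenyiEntropy α) ψ) ∧
    QuditMagic.IsExtremalOnPureStates QuditMagic.stabilizerFidelity ψ ∧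
    QuditMagic.IsExtremalOnPureStates QuditMagic.minRelativeEntropyOfMagic ψ :=
  ⟨fun hd => hψ.isExtremalOnPureStates_mana hd,
    fun _ hα => hψ.isExtremalOnPureStates_stabilizerRenyiEntropy (one_le_two.trans hα),
    hψ.isExtremalOnPureStates_stabilizerFidelity,
    hψ.isExtremalOnPureStates_minRelativeEntropyOfMagic⟩
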